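/- Let $A$ be a finite alphabet, $\pi$ a probability distribution on $A$ with $0<\pi(\alpha)<1$ for all $\alpha\in A$, and $X$ a non-empty word over $A$, of length $m$. A border of a word is a word that is both a prefix and a suffix of it; a prefix, suffix or border of $u$ is strict if it differs from $u$. *Algorithm.* Let $\mathrm{mp}_X(u)$ be the longest strict border of the prefix $u$ of $X$, with $\mathrm{mp}_X(\varepsilon)=\bot$. Let $\mathrm{kmp}_X(X)=\mathrm{mp}_X(X)$ and, for $u\alpha$ a prefix of $X$ with $\alpha\in A$, let $\mathrm{kmp}_X(u)$ be the longest strict suffix $v$ of $u$ that is a prefix of $u$ and such that $v\alpha$ is not a prefix of $u$, with $\mathrm{kmp}_X(u)=\bot$ if there is none. Let $b=\mathrm{mp}_X$ (algorithm MP) or $b=\mathrm{kmp}_X$ (algorithm KMP), and $B[i]=|b(X_0\cdots X_{i-1})|$ for $0\le i\le m$, where $|\bot|=-1$. On a text $W=W_0\cdots W_{n-1}$ the algorithm starts with $i=0$ and, for $j=0,\dots,n-1$: while $i\ge 0$ and $X[i]\ne W[j]$, it sets $i\leftarrow B[i]$; then $i\leftarrow i+1$; then, if $i=m$, $i\leftarrow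 B[m]$. The test $X[i]\neq W[j]$ is evaluated only if $i\ge0$; each evaluation is recorded as $T$ (taken) if it is true and $N$ (not taken) if it is false. *Predictor.* The 2-bit saturating counter has the states $\underline\nu,\nu,\tau,\underline\tau$, in this order from left to right; it moves one step right on $T$ and one step left on $N$ (staying in place at the ends). It predicts $N$ in $\underline\nu,\nu$ and $T$ in $\tau,\underline\tau$; a misprediction occurs when the outcome differs from the prediction. For $s\in\{N,T\}^*$ let $\xi(\lambda,s)$ be the state reached from $\lambda$ by following $s$, and $\mu(\lambda,s)$ the number of mispredictions on the way. For an initial state $\lambda_0$, let $M_n(\lambda_0)=\mu(\lambda_0,s)$, where $s$ is the sequence of outcomes of all the tests $X[i]\ne W[j]$ made by the algorithm on a random text $W$ of length $n$ with independent letters of law $\pi$. *Transducers.* Let $Q_X$ be the set of strict prefixes of $X$ and, for $u\in Q_X$ and $\alpha\in A$, let $\delta_X(u,\alpha)$ be the longest suffix of $u\alpha$ that is in $Q_X$. The transducer $T_X$ has the transitions $u\to\delta_X(u,\alpha)$ on reading $\alpha$, with output $$o(u,\alpha)=\begin{cases}N&\text{if }u\alpha\in Q_X\text{ or }u\alpha=X,\\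 T&\text{otherwise, if }b(u)=\bot,\\ T\cdot o(b(u),\alpha)&\text{otherwise.}\end{cases}$$ The product transducer $P_X$ has the states $Q_X\times\{\underline\nu,\nu,\tau,\underline\tau\}$; from $(u,\lambda)$, reading $\alpha$, it moves to $(\delta_X(u,\alpha),\xi(\lambda,o(u,\alpha)))$ and outputs the integer $\mu(\lambda,o(u,\alpha))$. It becomes a Markov chain when each transition reading $\alpha$ is given the weight $\pi(\alpha)$. **Proposition.** For both KMP and MP, this Markov chain has a unique stationary distribution $\pi_0$, and with $$L_X=\sum_{u\in Q_X}\ \sum_{\lambda\in\{\underline\nu,\nu,\tau,\underline\tau\}}\pi_0(u,\lambda)\sum_{\alpha\in A}\pi(\alpha)\,\mu(\lambda,o(u,\alpha))$$ one has, for every initial state $\lambda_0$ of the predictor, $$\mathbb E[M_n(\lambda_0)]\sim L_X\cdot n\qquad(n\to\infty).$$ In particular, the limit of $\mathbb E[M_n(\lambda_0)]/n$ does not depend on $\lambda_0$. -/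

import Mathlib

/-- Outcome of a conditional branch: `N` (not taken, the test is false) or `T` (taken, the test
is true). -/
inductive Branch
  | N
  | T
  deriving DecidableEq

/-- The four states of the 2-bit saturating counter, from left to right. -/
inductive Predictor
  | stronglyNotTaken
  | weaklyNotTaken
  | weaklyTaken
  | stronglyTaken
  deriving DecidableEq

namespace Predictor

instance : Fintype Predictor where
  elems := {stronglyNotTaken, weaklyNotTaken, weaklyTaken, stronglyTaken}
  complete := fun l => by cases l <;> decide

/-- The outcome that the predictor announces in a given state. -/
def prediction : Predictor → Branch
  | stronglyNotTaken => Branch.N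
  | weaklyNotTaken => Branch.N
  | weaklyTaken => Branch.T
  | stronglyTaken => Branch.T

/-- One update of the predictor: one step to the right on `T`, one step to the left on `N`,
saturating at both ends. -/
def step : Predictor → Branch → Predictor
  | stronglyNotTaken, Branch.N => stronglyNotTaken
  | weaklyNotTaken, Branch.N => stronglyNotTaken
  | weaklyTaken, Branch.N => weaklyNotTaken
  | stronglyTaken, Branch.N => weaklyTaken
  | stronglyNotTaken, Branch.T => weaklyNotTaken
  | weaklyNotTaken, Branch.T => weaklyTaken
  | weaklyTaken, Branch.T => stronglyTaken
  | stronglyTaken, Branch.T => stronglyTaken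

/-- `ξ(l, s)`: state reached from `l` after the sequence of outcomes `s`. -/
def run : Predictor → List Branch → Predictor
  | l, [] => l
  | l, b :: s => run (l.step b) s

/-- `μ(l, s)`: number of mispredictions along the sequence of outcomes `s` from state `l`. -/
def mispredictions : Predictor → List Branch → ℕ
  | _, [] => 0
  | l, b :: s => (if l.prediction = b then 0 else 1) + mispredictions (l.step b) s

end Predictor

/-- The two pattern matching algorithms: Morris-Pratt and Knuth-Morris-Pratt. -/
inductive Algorithm
  | MP
  | KMP

namespace PatternMatching

/-- The longest strict border of `u` (`none` stands for `⊥`, the value at the empty word).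
The list `u.tails.tail` enumerates the strict suffixes of `u` by decreasing length. -/
def mp {A : Type*} [DecidableEq A] (u : List A) : Option (List A) :=
  u.tails.tail.find? (fun v => decide (v <+: u))

/-- The refined failure function: at `X` it is `mp X`; if `u ++ [a]` is a prefix of `X`, it is the
longest strict suffix `v` of `u` that is a prefix of `u` and such that `v ++ [a]` is not a prefix
of `u`, and `none` (that is, `⊥`) if there is no such suffix. It is used at prefixes `u` of `X`
only, where `X[u.length]?` is the letter `a` that follows `u` in `X`, or `none` if `u = X`. -/
def kmp {A : Type*} [DecidableEq A] (X u : List A) : Option (List A) :=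
  match X[u.length]? with
  | none => mp u
  | some a => u.tails.tail.find? (fun v => decide (v <+: u ∧ ¬ (v ++ [a] <+: u)))

/-- The failure function `mp_X` or `kmp_X`. -/
def failure {A : Type*} [DecidableEq A] (alg : Algorithm) (X u : List A) : Option (List A) :=
  match alg with
  | Algorithm.MP => mp u
  | Algorithm.KMP => kmp X u

theorem length_lt_of_mem_tails_tail {A : Type*} {u v : List A} (h : v ∈ u.tails.tail) :
    v.length < u.length := by
  cases u with
  | nil => simp at h
  | cons a u =>
    simp only [List.tails, List.tail_cons, List.mem_tails] at h
    have := h.length_le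
    simp only [List.length_cons]
    omega

theorem length_lt_of_failure {A : Type*} [DecidableEq A] {alg : Algorithm} {X u v : List A}
    (h : failure alg X u = some v) : v.length < u.length := by
  cases alg with
  | MP => exact length_lt_of_mem_tails_tail (List.mem_of_find?_eq_some h)
  | KMP =>
    simp only [failure, kmp] at h
    split at h
    · exact length_lt_of_mem_tails_tail (List.mem_of_find?_eq_some h)
    · exact length_lt_of_mem_tails_tail (List.mem_of_find?_eq_some h)

/-! ### The algorithm -/

/-- The table `B[i] = |b(pref(X, i))|`, where `b` is the failure function and `|⊥| = -1`. -/
def table {A : Type*} [DecidableEq A] (alg : Algorithm) (X : List A) (i : ℕ) : ℤ :=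
  match failure alg X (X.take i) with
  | none => -1
  | some v => v.length

theorem table_lt {A : Type*} [DecidableEq A] (alg : Algorithm) (X : List A) (i : ℕ) :
    table alg X i < i := by
  unfold table
  split
  · omega
  · next v h =>
    have h1 := length_lt_of_failure h
    have h2 := List.length_take_le i X
    omega

/-- The inner loop `while i ≥ 0 and X[i] ≠ c do i ← B[i]`, where `c = W[j]`. It returns the outcomes
of the successive evaluations of the test `X[i] ≠ c` (which is evaluated only if `i ≥ 0`),
and the final value of `i`. -/
def innerLoop {A : Type*} [DecidableEq A] (alg : Algorithm) (X : List A) (c : A) (i : ℤ) :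
    List Branch × ℤ :=
  if 0 ≤ i then
    if X[i.toNat]? ≠ some c then
      (Branch.T :: (innerLoop alg X c (table alg X i.toNat)).1,
        (innerLoop alg X c (table alg X i.toNat)).2)
    else ([Branch.N], i)
  else ([], i)
termination_by (i + 1).toNat
decreasing_by
  all_goals
    have := table_lt alg X i.toNat
    omega

/-- The update of `i` at the end of an iteration of the main loop:
`i ← i + 1`, then `if i = m then i ← B[i]`. -/
def advance {A : Type*} [DecidableEq A] (alg : Algorithm) (X : List A) (i : ℤ) : ℤ :=
  if i + 1 = X.length then table alg X X.length else i + 1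

/-- The main loop on the letters that remain to be read, from the current value of `i`: the
outcomes of all the evaluations of the test `X[i] ≠ W[j]`, in order. The counter of occurrences
is left out, as it has no effect on the control flow. -/
def mainLoop {A : Type*} [DecidableEq A] (alg : Algorithm) (X : List A) : List A → ℤ → List Branch
  | [], _ => []
  | c :: W, i =>
    (innerLoop alg X c i).1 ++ mainLoop alg X W (advance alg X (innerLoop alg X c i).2)

/-- The outcomes of the letter comparisons `X[i] ≠ W[j]` performed by the algorithm on the
text `W`. -/
def letterComparisons {A : Type*} [DecidableEq A] (alg : Algorithm) (X W : List A) : List Branch :=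
  mainLoop alg X W 0

/-- The number of mispredictions caused by the letter comparisons on the text `W`, when the local
predictor of this branch starts in state `l₀`. -/
def letterMispredictions {A : Type*} [DecidableEq A] (alg : Algorithm) (X : List A)
    (l₀ : Predictor) (W : List A) : ℕ :=
  l₀.mispredictions (letterComparisons alg X W)

/-- The expectation of the number of mispredictions caused by the letter comparisons on a random
text of length `n` drawn with probability `∏ i, p (W i)`. -/
noncomputable def expectedLetterMispredictions {A : Type*} [Fintype A] [DecidableEq A]
    (alg : Algorithm) (X : List A) (p : A → ℝ) (l₀ : Predictor) (n : ℕ) : ℝ :=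
  ∑ W : Fin n → A, (∏ i, p (W i)) * (letterMispredictions alg X l₀ (List.ofFn W) : ℝ)

/-! ### The transducers -/

/-- The set `Q_X` of strict prefixes of `X`. -/
def strictPrefixes {A : Type*} [DecidableEq A] (X : List A) : Finset (List A) :=
  X.inits.toFinset.erase X

/-- The transition function `δ_X`: the longest suffix of `u ++ [a]` that is in `Q_X`. The list
`(u ++ [a]).tails` enumerates the suffixes by decreasing length; the default value is never used
when `X` is non-empty, as then the empty word is in `Q_X`. -/
def delta {A : Type*} [DecidableEq A] (X u : List A) (a : A) : List A :=
  ((u ++ [a]).tails.find? (fun v => decide (v ∈ strictPrefixes X))).getD []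

/-- The output of the transition from `u` reading `a` in the transducer `T_X` of the algorithm. -/
def output {A : Type*} [DecidableEq A] (alg : Algorithm) (X u : List A) (a : A) : List Branch :=
  if u ++ [a] ∈ strictPrefixes X ∨ u ++ [a] = X then [Branch.N]
  else
    match h : failure alg X u with
    | none => [Branch.T]
    | some v => Branch.T :: output alg X v a
termination_by u.length
decreasing_by exact length_lt_of_failure h

/-- The states of the product transducer `P_X`: `Q_X` times the states of the predictor. -/
abbrev ProductState {A : Type*} [DecidableEq A] (X : List A) : Type _ :=
  strictPrefixes X × Predictor

/-- The target `(δ_X(u, a), ξ(l, s))` of the transition of `P_X` from `(u, l)` reading `a`, where `s`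
is the output of `T_X`. -/
def productTarget {A : Type*} [DecidableEq A] (alg : Algorithm) (X : List A)
    (q : ProductState X) (a : A) : List A × Predictor :=
  (delta X q.1 a, q.2.run (output alg X q.1 a))

/-- The output `μ(l, s)` of the transition of `P_X` from `(u, l)` reading `a`, where `s` is the
output of `T_X`. -/
def productOutput {A : Type*} [DecidableEq A] (alg : Algorithm) (X : List A)
    (q : ProductState X) (a : A) : ℕ :=
  q.2.mispredictions (output alg X q.1 a)

/-- The transition matrix of the Markov chain obtained from `P_X` by giving the weight `p a` to
every transition that reads `a`. -/
noncomputable def productChain {A : Type*} [Fintype A] [DecidableEq A] (alg : Algorithm)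
    (X : List A) (p : A → ℝ) : Matrix (ProductState X) (ProductState X) ℝ :=
  Matrix.of fun q r =>
    ∑ a, if productTarget alg X q a = ((r.1 : List A), r.2) then p a else 0

/-- `d` is a stationary distribution of the Markov chain with transition matrix `M`. -/
def IsStationaryDistribution {S : Type*} [Fintype S] (M : Matrix S S ℝ) (d : S → ℝ) : Prop :=
  (∀ s, 0 ≤ d s) ∧ ∑ s, d s = 1 ∧ Matrix.vecMul d M = d

/-- The constant `L_X`: the expected number of mispredictions per step, computed from a
distribution `d` on the states of `P_X`. -/
noncomputable def mispredictionRate {A : Type*} [Fintype A] [DecidableEq A] (alg : Algorithm)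
    (X : List A) (p : A → ℝ) (d : ProductState X → ℝ) : ℝ :=
  ∑ u : strictPrefixes X, ∑ l : Predictor,
    d (u, l) * ∑ a, p a * (productOutput alg X (u, l) a : ℝ)

end PatternMatching

/-! Before each letter is read, `i` is the length of a state of `T_X`, and one iteration of the main
loop performs one transition of `T_X`, for MP and KMP alike (`innerLoop_eq`). So the number of
mispredictions is an additive functional of the automaton `P_X` fed with independent letters.

Since every letter has probability less than 1, some letter `c` differs from the first letter of
`X`, and reading `c` exactly `|X| + 3` times sends every state of `P_X` to `(ε, stronglyTaken)`
(`productStep_iterate`). Every non-zero invariant non-negative measure therefore charges this state,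
so no two of them have disjoint supports, and the invariant signed measures form a line. By duality
the range of `1 - P` is the kernel of the stationary distribution `d`. The Poisson equation `h - P h
= g - d(g)` is thus solvable for the expected cost `g` of one step, and the expectation is `L_X n +
O(1)`; no convergence of the law of the chain is needed.

Finally `L_X > 0`: `d` charges `(ε, stronglyTaken)`, where reading the first letter of `X` is
mispredicted. The bounded error is therefore negligible. -/

/-! ### Finite automata driven by independent letters -/

section LetterChain

variable {A S : Type*} [Fintype A] [DecidableEq S]

/-- The transition matrix of the Markov chain obtained by feeding letters of law `p` to the
automaton with transition function `t`. -/
def letterChain (t : S → A → S) (p : A → ℝ) : Matrix S S ℝ :=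
  Matrix.of fun s r => ∑ a, if t s a = r then p a else 0

theorem letterChain_nonneg (t : S → A → S) {p : A → ℝ} (hp : ∀ a, 0 < p a) (s r : S) :
    0 ≤ letterChain t p s r := by
  simp only [letterChain, Matrix.of_apply]
  exact Finset.sum_nonneg fun a _ => by split_ifs <;> simp [(hp a).le]

theorem letterChain_pos (t : S → A → S) {p : A → ℝ} (hp : ∀ a, 0 < p a) (s : S) (c : A) :
    0 < letterChain t p s (t s c) := by
  simp only [letterChain, Matrix.of_apply]
  refine Finset.sum_pos' (fun a _ => by split_ifs <;> simp [(hp a).le]) ⟨c, Finset.mem_univ _, ?_⟩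
  simpa using hp c

variable [Fintype S]

theorem letterChain_mulVec (t : S → A → S) (p : A → ℝ) (h : S → ℝ) (s : S) :
    (letterChain t p).mulVec h s = ∑ a, p a * h (t s a) := by
  simp only [Matrix.mulVec, dotProduct, letterChain, Matrix.of_apply, Finset.sum_mul]
  rw [Finset.sum_comm]
  simp

theorem sum_vecMul_letterChain (t : S → A → S) {p : A → ℝ} (hp_sum : ∑ a, p a = 1) (x : S → ℝ) :
    ∑ s, Matrix.vecMul x (letterChain t p) s = ∑ s, x s := by
  simp only [Matrix.vecMul, dotProduct, letterChain, Matrix.of_apply]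
  rw [Finset.sum_comm]
  refine Finset.sum_congr rfl fun s _ => ?_
  rw [← Finset.mul_sum, Finset.sum_comm]
  simp [hp_sum]

/-- The absolute value of an invariant signed measure is invariant. -/
theorem vecMul_abs_letterChain (t : S → A → S) {p : A → ℝ} (hp : ∀ a, 0 < p a)
    (hp_sum : ∑ a, p a = 1) {x : S → ℝ} (hx : Matrix.vecMul x (letterChain t p) = x) :
    Matrix.vecMul (fun s => |x s|) (letterChain t p) = fun s => |x s| := by
  -- The triangle inequality gives `|x| ≤ |x| P`; both sides have the same total mass, so they agree
  -- pointwise.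
  have hle : ∀ s ∈ Finset.univ,
      |x s| ≤ Matrix.vecMul (fun s => |x s|) (letterChain t p) s := by
    intro s _
    conv_lhs => rw [← hx]
    simp only [Matrix.vecMul, dotProduct]
    refine (Finset.abs_sum_le_sum_abs _ _).trans (Finset.sum_le_sum fun r _ => ?_)
    rw [abs_mul, abs_of_nonneg (letterChain_nonneg t hp r s)]
  have hsum := sum_vecMul_letterChain t hp_sum (fun s => |x s|)
  ext s
  exact ((Finset.sum_eq_sum_iff_of_le hle).1 hsum.symm s (Finset.mem_univ s)).symm

/-- A non-zero invariant measure charges the state to which a word of the form `c ⋯ c` leads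
from everywhere. -/
theorem pos_of_vecMul_letterChain_eq (t : S → A → S) {p : A → ℝ} (hp : ∀ a, 0 < p a)
    {c : A} {k : ℕ} {s₀ : S} (hsync : ∀ s, (fun r => t r c)^[k] s = s₀) {y : S → ℝ}
    (hy0 : ∀ s, 0 ≤ y s) (hy : Matrix.vecMul y (letterChain t p) = y) {s : S} (hs : 0 < y s) :
    0 < y s₀ := by
  have hstep : ∀ r, 0 < y r → 0 < y (t r c) := by
    intro r hr
    rw [← hy]
    simp only [Matrix.vecMul, dotProduct]
    exact Finset.sum_pos' (fun q _ => mul_nonneg (hy0 q) (letterChain_nonneg t hp q _))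
      ⟨r, Finset.mem_univ _, mul_pos hr (letterChain_pos t hp r c)⟩
  rw [← hsync s]
  clear hsync
  induction k with
  | zero => exact hs
  | succ k ih =>
    rw [Function.iterate_succ_apply']
    exact hstep _ ih

/-- An invariant signed measure of total mass zero vanishes. -/
theorem eq_zero_of_vecMul_letterChain_eq (t : S → A → S) {p : A → ℝ} (hp : ∀ a, 0 < p a)
    (hp_sum : ∑ a, p a = 1) {c : A} {k : ℕ} {s₀ : S}
    (hsync : ∀ s, (fun r => t r c)^[k] s = s₀) {x : S → ℝ}
    (hx : Matrix.vecMul x (letterChain t p) = x) (hsum : ∑ s, x s = 0) : x = 0 := by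
  have habs := vecMul_abs_letterChain t hp hp_sum hx
  -- If `x` took both signs, `|x| + x` and `|x| - x` would be non-zero invariant measures, both
  -- charging `s₀`; but one of them vanishes there.
  have key : (∀ s, 0 ≤ x s) ∨ ∀ s, x s ≤ 0 := by
    by_contra! hcon
    obtain ⟨⟨s, hs⟩, r, hr⟩ := hcon
    have h1 : 0 < |x s₀| + x s₀ :=
      pos_of_vecMul_letterChain_eq t hp hsync (y := (fun s => |x s|) + x) (s := r)
        (fun q => by have := neg_abs_le (x q); simp only [Pi.add_apply]; linarith)
        (by rw [Matrix.add_vecMul, habs, hx])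
        (by have := abs_nonneg (x r); simp only [Pi.add_apply]; linarith)
    have h2 : 0 < |x s₀| - x s₀ :=
      pos_of_vecMul_letterChain_eq t hp hsync (y := (fun s => |x s|) - x) (s := s)
        (fun q => by have := le_abs_self (x q); simp only [Pi.sub_apply]; linarith)
        (by rw [Matrix.sub_vecMul, habs, hx])
        (by have := abs_nonneg (x s); simp only [Pi.sub_apply]; linarith)
    rcases abs_choice (x s₀) with h | h <;> rw [h] at h1 h2 <;> linarith
  ext s
  rcases key with h | h
  · exact (Finset.sum_eq_zero_iff_of_nonneg fun r _ => h r).1 hsum s (Finset.mem_univ s)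
  · exact (Finset.sum_eq_zero_iff_of_nonpos fun r _ => h r).1 hsum s (Finset.mem_univ s)

theorem exists_isStationaryDistribution_letterChain [Nonempty S] (t : S → A → S) {p : A → ℝ}
    (hp : ∀ a, 0 < p a) (hp_sum : ∑ a, p a = 1) :
    ∃ d, PatternMatching.IsStationaryDistribution (letterChain t p) d := by
  -- The constant function 1 is fixed by `P`, so `P - 1` is singular and has a non-zero left null
  -- vector; its normalized absolute value is the distribution sought.
  have hright : ∃ v ≠ 0, (letterChain t p - 1).mulVec v = 0 := by
    refine ⟨fun _ => 1, fun h => one_ne_zero (congrFun h (Classical.arbitrary S)), ?_⟩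
    ext s
    rw [Matrix.sub_mulVec, Pi.sub_apply, letterChain_mulVec]
    simp [hp_sum]
  obtain ⟨x, hx0, hx⟩ :=
    Matrix.exists_vecMul_eq_zero_iff.2 (Matrix.exists_mulVec_eq_zero_iff.1 hright)
  rw [Matrix.vecMul_sub, Matrix.vecMul_one, sub_eq_zero] at hx
  have habs := vecMul_abs_letterChain t hp hp_sum hx
  obtain ⟨r, hr⟩ := Function.ne_iff.1 hx0
  have hpos : 0 < ∑ s, |x s| :=
    Finset.sum_pos' (fun s _ => abs_nonneg _) ⟨r, Finset.mem_univ _, abs_pos.2 hr⟩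
  refine ⟨(∑ s, |x s|)⁻¹ • fun s => |x s|, fun s => ?_, ?_, ?_⟩
  · exact mul_nonneg (inv_nonneg.2 hpos.le) (abs_nonneg _)
  · simp only [Pi.smul_apply, smul_eq_mul, ← Finset.mul_sum]
    exact inv_mul_cancel₀ hpos.ne'
  · rw [Matrix.smul_vecMul, habs]

/-- The Poisson equation `h - P h = g - d(g)` has a solution. -/
theorem exists_poisson_solution (t : S → A → S) {p : A → ℝ} (hp : ∀ a, 0 < p a)
    (hp_sum : ∑ a, p a = 1) {c : A} {k : ℕ} {s₀ : S}
    (hsync : ∀ s, (fun r => t r c)^[k] s = s₀) {d : S → ℝ}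
    (hd : PatternMatching.IsStationaryDistribution (letterChain t p) d) (g : S → ℝ) :
    ∃ h : S → ℝ, ∀ s, h s - ∑ a, p a * h (t s a) = g s - ∑ r, d r * g r := by
  set L := ∑ r, d r * g r with hL
  suffices hmem : (fun s => g s - L) ∈ LinearMap.range (1 - letterChain t p).mulVecLin by
    obtain ⟨h, hh⟩ := hmem
    refine ⟨h, fun s => ?_⟩
    have := congrFun hh s
    rwa [Matrix.mulVecLin_apply, Matrix.sub_mulVec, Matrix.one_mulVec, Pi.sub_apply,
      letterChain_mulVec] at this
  -- Otherwise a linear form `φ` vanishes on the range of `1 - P` but not at `g - L`. Its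
  -- coefficients `x` form an invariant signed measure, hence a multiple of `d`, and `d` annihilates
  -- `g - L`.
  by_contra hnot
  obtain ⟨φ, hφ, hle⟩ := Submodule.exists_le_ker_of_notMem hnot
  set x : S → ℝ := fun s => φ (Pi.single s 1) with hx
  have hφx : ∀ f : S → ℝ, φ f = ∑ s, x s * f s := by
    intro f
    rw [LinearMap.pi_apply_eq_sum_univ φ f]
    refine Finset.sum_congr rfl fun s _ => ?_
    rw [smul_eq_mul, mul_comm, hx]
    congr 2
    ext r
    simp [Pi.single_apply, eq_comm]
  have hxM : Matrix.vecMul x (letterChain t p) = x := by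
    ext r
    have h1 : φ ((1 - letterChain t p).mulVecLin (Pi.single r 1)) = 0 :=
      hle (LinearMap.mem_range_self _ _)
    rw [hφx] at h1
    simp only [Matrix.mulVecLin_apply, Matrix.mulVec_single_one, Matrix.col_apply,
      Matrix.sub_apply, Matrix.one_apply, mul_sub, Finset.sum_sub_distrib, mul_ite, mul_one,
      mul_zero, Finset.sum_ite_eq', Finset.mem_univ, if_true] at h1
    simp only [Matrix.vecMul, dotProduct]
    linarith
  obtain ⟨-, hd1, hdM⟩ := hd
  have hzero : x - (∑ s, x s) • d = 0 := by
    refine eq_zero_of_vecMul_letterChain_eq t hp hp_sum hsync ?_ ?_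
    · rw [Matrix.sub_vecMul, Matrix.smul_vecMul, hxM, hdM]
    · simp [Finset.sum_sub_distrib, ← Finset.mul_sum, hd1]
  apply hφ
  rw [hφx, sub_eq_zero.1 hzero]
  simp only [Pi.smul_apply, smul_eq_mul, mul_assoc, ← Finset.mul_sum, mul_sub,
    Finset.sum_sub_distrib, ← Finset.sum_mul, hd1, ← hL]
  ring

/-- Additive functionals of the chain differ from their linear growth by a bounded amount. -/
theorem exists_abs_sub_le_of_letterChain (t : S → A → S) {p : A → ℝ} (hp : ∀ a, 0 < p a)
    (hp_sum : ∑ a, p a = 1) {c : A} {k : ℕ} {s₀ : S}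
    (hsync : ∀ s, (fun r => t r c)^[k] s = s₀) {d : S → ℝ}
    (hd : PatternMatching.IsStationaryDistribution (letterChain t p) d) (g : S → ℝ)
    {E : ℕ → S → ℝ} (hE0 : ∀ s, E 0 s = 0)
    (hE : ∀ n s, E (n + 1) s = g s + ∑ a, p a * E n (t s a)) :
    ∃ C, ∀ n s, |E n s - (∑ r, d r * g r) * n| ≤ C := by
  obtain ⟨h, hh⟩ := exists_poisson_solution t hp hp_sum hsync hd g
  set L := ∑ r, d r * g r
  have hC : ∀ s, |h s| ≤ ∑ r, |h r| := fun s =>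
    Finset.single_le_sum (f := fun r => |h r|) (fun r _ => abs_nonneg _) (Finset.mem_univ s)
  -- The remainder `D n = E n - L n - h` satisfies `D 0 = -h` and `D (n + 1) = P (D n)`, and
  -- averaging by `P` preserves a uniform bound.
  have key : ∀ n s, |E n s - L * n - h s| ≤ ∑ r, |h r| := by
    intro n
    induction n with
    | zero => intro s; simpa [hE0] using hC s
    | succ n ih =>
      intro s
      have heq : E (n + 1) s - L * (n + 1 : ℕ) - h s =
          ∑ a, p a * (E n (t s a) - L * n - h (t s a)) := by
        simp only [mul_sub, Finset.sum_sub_distrib, ← Finset.sum_mul, hp_sum, hE]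
        have := hh s
        push_cast
        linarith
      rw [heq]
      calc |∑ a, p a * (E n (t s a) - L * n - h (t s a))|
          ≤ ∑ a, |p a * (E n (t s a) - L * n - h (t s a))| := Finset.abs_sum_le_sum_abs _ _
        _ ≤ ∑ a, p a * ∑ r, |h r| := Finset.sum_le_sum fun a _ => by
            rw [abs_mul, abs_of_pos (hp a)]
            exact mul_le_mul_of_nonneg_left (ih _) (hp a).le
        _ = ∑ r, |h r| := by rw [← Finset.sum_mul, hp_sum, one_mul]
  refine ⟨2 * ∑ r, |h r|, fun n s => ?_⟩
  calc |E n s - L * n| = |(E n s - L * n - h s) + h s| := by ring_nf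
    _ ≤ |E n s - L * n - h s| + |h s| := abs_add_le _ _
    _ ≤ 2 * ∑ r, |h r| := by linarith [key n s, hC s]

end LetterChain

/-! ### The algorithm follows the transducer -/

theorem Predictor.mispredictions_append (l : Predictor) (s r : List Branch) :
    l.mispredictions (s ++ r) = l.mispredictions s + (l.run s).mispredictions r := by
  induction s generalizing l with
  | nil => simp [mispredictions, run]
  | cons b s ih => simp [mispredictions, run, ih, Nat.add_assoc]

theorem List.find?_tails_eq_some_iff {A : Type*} {P : List A → Bool} {l w : List A} :
    l.tails.find? P = some w ↔
      w <:+ l ∧ P w ∧ ∀ v, v <:+ l → P v → v.length ≤ w.length := by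
  induction l with
  | nil =>
    simp only [List.tails, List.find?_singleton, List.suffix_nil, Option.ite_none_right_eq_some,
      Option.some.injEq]
    constructor
    · rintro ⟨h, rfl⟩
      exact ⟨rfl, h, by simp⟩
    · rintro ⟨rfl, h, -⟩
      exact ⟨h, rfl⟩
  | cons a l ih =>
    rw [List.tails, List.find?_cons]
    cases h : P (a :: l)
    · rw [ih]
      constructor
      · rintro ⟨h1, h2, h3⟩
        refine ⟨h1.trans (List.suffix_cons a l), h2, fun v hv hP => ?_⟩
        rcases List.suffix_cons_iff.1 hv with rfl | hv
        · simp [h] at hP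
        · exact h3 v hv hP
      · rintro ⟨h1, h2, h3⟩
        rcases List.suffix_cons_iff.1 h1 with rfl | h1
        · simp [h] at h2
        · exact ⟨h1, h2, fun v hv hP => h3 v (hv.trans (List.suffix_cons a l)) hP⟩
    · simp only [Option.some.injEq]
      constructor
      · rintro rfl
        exact ⟨List.suffix_rfl, h, fun v hv _ => hv.length_le⟩
      · rintro ⟨h1, -, h3⟩
        exact (h1.eq_of_length_le (h3 _ List.suffix_rfl h)).symm

theorem List.mem_tails_tail {A : Type*} {l v : List A} :
    v ∈ l.tails.tail ↔ v <:+ l ∧ v ≠ l := by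
  cases l with
  | nil => simp
  | cons a l =>
    simp only [List.tails, List.tail_cons, List.mem_tails, List.suffix_cons_iff]
    constructor
    · intro h
      refine ⟨Or.inr h, ?_⟩
      rintro rfl
      have := h.length_le
      simp at this
    · rintro ⟨rfl | h, h'⟩
      · exact absurd rfl h'
      · exact h

/-- Suffixes of one list are nested, and the first match is the longest. -/
theorem List.suffix_of_find?_tails_tail_eq_some {A : Type*} {P : List A → Bool} {l w v : List A}
    (h : l.tails.tail.find? P = some w) (hv : v <:+ l) (hne : v ≠ l) (hP : P v) : v <:+ w := by
  cases l with
  | nil => simp at h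
  | cons a l =>
    obtain ⟨h1, -, h3⟩ := List.find?_tails_eq_some_iff.1 (by simpa [List.tails] using h)
    rcases List.suffix_cons_iff.1 hv with rfl | hv
    · exact absurd rfl hne
    · exact List.suffix_of_suffix_length_le hv h1 (h3 v hv hP)

namespace PatternMatching

theorem sum_prod_eq_one {A : Type*} [Fintype A] {p : A → ℝ} (hp_sum : ∑ a, p a = 1) (n : ℕ) :
    ∑ W : Fin n → A, ∏ i, p (W i) = 1 := by
  rw [← Fintype.piFinset_univ, Finset.sum_prod_piFinset]
  simp [hp_sum]

/-- Links the test `X[i] ≠ c` to the prefix condition of the transducer. For `u = X` there is no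
next letter and both sides are false. -/
theorem append_singleton_prefix_iff {A : Type*} {X u : List A} (hu : u <+: X) (c : A) :
    u ++ [c] <+: X ↔ X[u.length]? = some c := by
  obtain ⟨v, rfl⟩ := hu
  cases v with
  | nil =>
    simp only [List.append_nil, List.getElem?_length, reduceCtorEq, iff_false]
    intro h
    simpa using h.length_le
  | cons a v => simp [List.prefix_append_right_inj, eq_comm]

/-! ### Prefix automaton and failure functions -/

section Transducer

variable {A : Type*} [DecidableEq A]

theorem mem_strictPrefixes {X u : List A} : u ∈ strictPrefixes X ↔ u <+: X ∧ u ≠ X := by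
  simp [strictPrefixes, and_comm]

theorem nil_mem_strictPrefixes {X : List A} (hX : X ≠ []) : [] ∈ strictPrefixes X :=
  mem_strictPrefixes.2 ⟨List.nil_prefix, hX.symm⟩

theorem length_lt_of_mem_strictPrefixes {X u : List A} (hu : u ∈ strictPrefixes X) :
    u.length < X.length := by
  obtain ⟨h1, h2⟩ := mem_strictPrefixes.1 hu
  exact lt_of_le_of_ne h1.length_le fun h => h2 (h1.eq_of_length h)

theorem mem_strictPrefixes_of_length_lt {X u : List A} (hu : u <+: X)
    (h : u.length < X.length) : u ∈ strictPrefixes X :=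
  mem_strictPrefixes.2 ⟨hu, by rintro rfl; exact lt_irrefl _ h⟩

theorem delta_spec {X : List A} (hX : X ≠ []) (u : List A) (c : A) :
    delta X u c <:+ u ++ [c] ∧ delta X u c ∈ strictPrefixes X ∧
      ∀ v, v <:+ u ++ [c] → v ∈ strictPrefixes X → v.length ≤ (delta X u c).length := by
  have hex : ((u ++ [c]).tails.find? (fun v => decide (v ∈ strictPrefixes X))).isSome := by
    rw [List.find?_isSome]
    exact ⟨[], by simp, by simpa using nil_mem_strictPrefixes hX⟩
  obtain ⟨w, hw⟩ := Option.isSome_iff_exists.1 hex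
  have hdw : delta X u c = w := by rw [delta, hw]; rfl
  rw [hdw]
  simpa using List.find?_tails_eq_some_iff.1 hw

theorem delta_eq_of_spec {X : List A} (hX : X ≠ []) {u w : List A} {c : A}
    (h1 : w <:+ u ++ [c]) (h2 : w ∈ strictPrefixes X)
    (h3 : ∀ v, v <:+ u ++ [c] → v ∈ strictPrefixes X → v.length ≤ w.length) :
    delta X u c = w := by
  obtain ⟨k1, k2, k3⟩ := delta_spec hX u c
  exact (List.suffix_of_suffix_length_le k1 h1 (h3 _ k1 k2)).eq_of_length_le (k3 _ h1 h2)

theorem delta_of_mem {X u : List A} {c : A} (h : u ++ [c] ∈ strictPrefixes X) :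
    delta X u c = u ++ [c] :=
  delta_eq_of_spec (by rintro rfl; simp [mem_strictPrefixes] at h) List.suffix_rfl h
    fun _ hv _ => hv.length_le

theorem failure_self (alg : Algorithm) (X : List A) : failure alg X X = mp X := by
  cases alg <;> simp [failure, kmp]

/-- What MP and KMP have in common: only borders of `u` are accepted, and none that the mismatching
letter `c` can extend is rejected. KMP rejects `v` only if the letter `a` expected after `u` also
follows `v` in `X`; then `c ≠ a` cannot follow `v`. -/
theorem failure_eq_find (alg : Algorithm) (X u : List A) :
    ∃ P : List A → Bool, failure alg X u = u.tails.tail.find? P ∧ (∀ v, P v → v <+: u) ∧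
      ∀ v a c, X[u.length]? = some a → a ≠ c → v ++ [c] <+: X → v <+: u → u <+: X → P v := by
  cases alg with
  | MP =>
    exact ⟨_, rfl, fun v hv => by simpa using hv, fun v a c _ _ _ hv _ => by simpa using hv⟩
  | KMP =>
    simp only [failure, kmp]
    split
    · next h =>
      exact ⟨_, rfl, fun v hv => by simpa using hv, fun v a c h' => by simp [h] at h'⟩
    · next b h =>
      refine ⟨_, rfl, fun v hv => (by simpa using hv : _ ∧ _).1, fun v a c h' hne hc hv hu => ?_⟩
      obtain rfl : b = a := by simpa [h] using h'
      simp only [decide_eq_true_eq]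
      refine ⟨hv, fun hb => hne ?_⟩
      have e1 := (append_singleton_prefix_iff (hv.trans hu) b).1 (hb.trans hu)
      have e2 := (append_singleton_prefix_iff (hv.trans hu) c).1 hc
      exact Option.some.inj (e1.symm.trans e2)

/-- On a mismatch, every suffix of `u ++ [c]` in `Q_X` is empty or comes from a suffix of `u` that
the failure function does not skip. -/
theorem exists_failure_of_suffix {alg : Algorithm} {X u z : List A} {c : A}
    (hu : u ∈ strictPrefixes X) (hc : ¬ u ++ [c] <+: X) (hz : z <:+ u ++ [c])
    (hzX : z ∈ strictPrefixes X) :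
    z = [] ∨ ∃ v, failure alg X u = some v ∧ z <:+ v ++ [c] := by
  rcases List.suffix_concat_iff.1 hz with rfl | ⟨y, rfl, hy⟩
  · exact Or.inl rfl
  right
  obtain ⟨P, hP, -, hP2⟩ := failure_eq_find alg X u
  have huX := (mem_strictPrefixes.1 hu).1
  have hyX := (mem_strictPrefixes.1 hzX).1
  have hne : y ≠ u := by rintro rfl; exact hc hyX
  have hyu : y <+: u :=
    List.prefix_of_prefix_length_le ((List.prefix_append y [c]).trans hyX) huX hy.length_le
  have hlt := length_lt_of_mem_strictPrefixes hu
  have hPy : P y := by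
    refine hP2 y X[u.length] c (List.getElem?_eq_getElem hlt) (fun h => hc ?_) hyX hyu huX
    rw [append_singleton_prefix_iff huX, List.getElem?_eq_getElem hlt, h]
  have hsome : (u.tails.tail.find? P).isSome :=
    List.find?_isSome.2 ⟨y, List.mem_tails_tail.2 ⟨hy, hne⟩, hPy⟩
  obtain ⟨v, hv⟩ := Option.isSome_iff_exists.1 hsome
  refine ⟨v, hP.trans hv, ?_⟩
  obtain ⟨r, hr⟩ := List.suffix_of_find?_tails_tail_eq_some hv hy hne hPy
  exact ⟨r, by rw [← List.append_assoc, hr]⟩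

theorem failure_spec {alg : Algorithm} {X u v : List A} (h : failure alg X u = some v) :
    v <:+ u ∧ v <+: u ∧ v ≠ u := by
  obtain ⟨P, hP, hP1, -⟩ := failure_eq_find alg X u
  rw [hP] at h
  obtain ⟨h1, h2⟩ := List.mem_tails_tail.1 (List.mem_of_find?_eq_some h)
  exact ⟨h1, hP1 v (List.find?_some h), h2⟩

theorem mem_strictPrefixes_of_failure {alg : Algorithm} {X u v : List A}
    (hu : u <+: X) (h : failure alg X u = some v) : v ∈ strictPrefixes X :=
  mem_strictPrefixes_of_length_lt ((failure_spec h).2.1.trans hu)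
    ((length_lt_of_failure h).trans_le hu.length_le)

theorem delta_of_failure_none {alg : Algorithm} {X u : List A} {c : A}
    (hu : u ∈ strictPrefixes X) (hc : ¬ u ++ [c] <+: X) (h : failure alg X u = none) :
    delta X u c = [] := by
  have hX : X ≠ [] := by rintro rfl; simp [mem_strictPrefixes] at hu
  obtain ⟨k1, k2, -⟩ := delta_spec hX u c
  rcases exists_failure_of_suffix (alg := alg) hu hc k1 k2 with h' | ⟨v, hv, -⟩
  · exact h'
  · simp [h] at hv

/-- Falling back to `v` loses no candidate, by `exists_failure_of_suffix`, and adds none, since `v`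
is a suffix of `u`. -/
theorem delta_of_failure_some {alg : Algorithm} {X u v : List A} {c : A}
    (hu : u ∈ strictPrefixes X) (hc : ¬ u ++ [c] <+: X) (h : failure alg X u = some v) :
    delta X u c = delta X v c := by
  have hX : X ≠ [] := by rintro rfl; simp [mem_strictPrefixes] at hu
  obtain ⟨k1, k2, k3⟩ := delta_spec hX v c
  refine delta_eq_of_spec hX (k1.trans ?_) k2 fun z hz hzX => ?_
  · obtain ⟨r, rfl⟩ := (failure_spec h).1
    exact ⟨r, by simp⟩
  · rcases exists_failure_of_suffix (alg := alg) hu hc hz hzX with rfl | ⟨v', hv', hz'⟩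
    · simp
    · obtain rfl : v = v' := by simpa [h] using hv'
      exact k3 z hz' hzX

/-- Justifies the jump to `B[m]` after an occurrence: the suffixes of `X` lying in `Q_X` are exactly
its strict borders. -/
theorem delta_of_eq {alg : Algorithm} {X u : List A} {c : A} (h : u ++ [c] = X) :
    failure alg X X = some (delta X u c) := by
  have hX : X ≠ [] := by rintro rfl; simp at h
  obtain ⟨k1, k2, k3⟩ := delta_spec hX u c
  rw [h] at k1 k3
  have hpre := mem_strictPrefixes.1 k2
  rw [failure_self, mp]
  have hsome : (X.tails.tail.find? fun v => decide (v <+: X)).isSome :=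
    List.find?_isSome.2
      ⟨delta X u c, List.mem_tails_tail.2 ⟨k1, hpre.2⟩, by simpa using hpre.1⟩
  obtain ⟨v, hv⟩ := Option.isSome_iff_exists.1 hsome
  have hv1 := List.mem_tails_tail.1 (List.mem_of_find?_eq_some hv)
  have hv2 : v <+: X := by simpa using List.find?_some hv
  have hle := k3 v hv1.1 (mem_strictPrefixes.2 ⟨hv2, hv1.2⟩)
  rw [hv, (List.suffix_of_find?_tails_tail_eq_some hv k1 hpre.2
    (by simpa using hpre.1)).eq_of_length_le hle]

/-! ### Outputs of the transducer and the inner loop -/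

theorem output_of_prefix {alg : Algorithm} {X u : List A} {c : A} (hc : u ++ [c] <+: X) :
    output alg X u c = [Branch.N] := by
  rw [output, if_pos]
  by_cases h : u ++ [c] = X
  · exact Or.inr h
  · exact Or.inl (mem_strictPrefixes.2 ⟨hc, h⟩)

theorem not_mem_or_eq_of_not_prefix {X u : List A} {c : A} (hc : ¬ u ++ [c] <+: X) :
    ¬ (u ++ [c] ∈ strictPrefixes X ∨ u ++ [c] = X) := by
  rintro (h | h)
  · exact hc (mem_strictPrefixes.1 h).1
  · exact hc (h ▸ List.prefix_rfl)

theorem output_of_failure_none {alg : Algorithm} {X u : List A} {c : A}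
    (hc : ¬ u ++ [c] <+: X) (h : failure alg X u = none) :
    output alg X u c = [Branch.T] := by
  rw [output, if_neg (not_mem_or_eq_of_not_prefix hc)]
  split
  · rfl
  · next v hv => simp [h] at hv

theorem output_of_failure_some {alg : Algorithm} {X u v : List A} {c : A}
    (hc : ¬ u ++ [c] <+: X) (h : failure alg X u = some v) :
    output alg X u c = Branch.T :: output alg X v c := by
  rw [output, if_neg (not_mem_or_eq_of_not_prefix hc)]
  split
  · next hv => simp [h] at hv
  · next w hv =>
    obtain rfl : v = w := by simpa [h] using hv
    rfl

theorem table_length {alg : Algorithm} {X u : List A} (hu : u <+: X) :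
    table alg X u.length = match failure alg X u with
      | none => -1
      | some v => (v.length : ℤ) := by
  rw [table, ← List.prefix_iff_eq_take.1 hu]

/-- The loop invariant, by induction on the length of the state: a failed comparison replaces `u` by
its failure value, which changes neither the target of the transition nor the rest of its output. -/
theorem innerLoop_eq (alg : Algorithm) {X : List A} (c : A) :
    ∀ (n : ℕ) (u : List A), u.length = n → u ∈ strictPrefixes X →
      (innerLoop alg X c u.length).1 = output alg X u c ∧
        advance alg X (innerLoop alg X c u.length).2 = (delta X u c).length := by
  intro n
  induction n using Nat.strong_induction_on with
  | _ n ih =>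
  intro u hn hu
  have huX := (mem_strictPrefixes.1 hu).1
  have hXpos : 0 < X.length := (Nat.zero_le _).trans_lt (length_lt_of_mem_strictPrefixes hu)
  rw [innerLoop, if_pos (Int.natCast_nonneg _), Int.toNat_natCast, table_length huX]
  by_cases hc : u ++ [c] <+: X
  · rw [if_neg (not_not.2 ((append_singleton_prefix_iff huX c).1 hc)), output_of_prefix hc]
    refine ⟨rfl, ?_⟩
    by_cases h : u ++ [c] = X
    · have hlen : (u.length : ℤ) + 1 = X.length := by rw [← h]; simp
      rw [advance, if_pos hlen, table_length List.prefix_rfl, delta_of_eq h]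
    · have hmem := mem_strictPrefixes.2 ⟨hc, h⟩
      have hlt := length_lt_of_mem_strictPrefixes hmem
      rw [List.length_append, List.length_singleton] at hlt
      rw [advance, if_neg (by omega), delta_of_mem hmem]
      simp
  · rw [if_pos (mt (append_singleton_prefix_iff huX c).2 hc)]
    cases h : failure alg X u with
    | none =>
      rw [output_of_failure_none hc h, delta_of_failure_none hu hc h, innerLoop]
      -- Here the loop exits with `i = -1`, so `i + 1 = 0`; the jump to `B[m]` is not triggered
      -- because `X` is non-empty.
      have hne : ¬ ((0 : ℤ) = X.length) := by omega
      simp [advance, hne]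
    | some v =>
      obtain ⟨h1, h2⟩ := ih v.length (hn ▸ length_lt_of_failure h) v rfl
        (mem_strictPrefixes_of_failure huX h)
      rw [output_of_failure_some hc h, delta_of_failure_some hu hc h]
      exact ⟨by rw [← h1], h2⟩

/-! ### Product automaton and its synchronization -/

/-- The transition function of the product transducer. -/
def productStep (alg : Algorithm) {X : List A} (hX : X ≠ []) (q : ProductState X) (a : A) :
    ProductState X :=
  (⟨delta X q.1 a, (delta_spec hX q.1 a).2.1⟩, q.2.run (output alg X q.1 a))

theorem mispredictions_mainLoop_cons (alg : Algorithm) {X : List A} (hX : X ≠ [])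
    (q : ProductState X) (a : A) (W : List A) :
    q.2.mispredictions (mainLoop alg X (a :: W) (q.1 : List A).length) =
      productOutput alg X q a + (productStep alg hX q a).2.mispredictions
        (mainLoop alg X W ((productStep alg hX q a).1 : List A).length) := by
  obtain ⟨h1, h2⟩ := innerLoop_eq alg a _ q.1 rfl q.1.2
  rw [mainLoop, h1, h2, Predictor.mispredictions_append]
  rfl

theorem delta_iterate_suffix (alg : Algorithm) {X : List A} (hX : X ≠ []) (q : ProductState X)
    (c : A) (k : ℕ) :
    (((fun r => productStep alg hX r c)^[k] q).1 : List A) <:+ q.1 ++ List.replicate k c := by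
  induction k with
  | zero => simp
  | succ k ih =>
    rw [Function.iterate_succ_apply', List.replicate_succ', ← List.append_assoc]
    refine (delta_spec hX _ c).1.trans ?_
    obtain ⟨r, hr⟩ := ih
    exact ⟨r, by rw [← List.append_assoc, hr]⟩

theorem productStep_nil (alg : Algorithm) {X : List A} (hX : X ≠ []) {c : A}
    (hc : ¬ [c] <+: X) (l : Predictor) :
    productStep alg hX (⟨[], nil_mem_strictPrefixes hX⟩, l) c =
      (⟨[], nil_mem_strictPrefixes hX⟩, l.step Branch.T) := by
  have hf : failure alg X [] = none := by
    cases h : failure alg X [] with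
    | none => rfl
    | some v => exact absurd (length_lt_of_failure h) (by simp)
  refine Prod.ext (Subtype.ext ?_) ?_
  · exact delta_of_failure_none (nil_mem_strictPrefixes hX) hc hf
  · simp only [productStep]
    rw [output_of_failure_none hc hf]
    rfl

/-- A long enough power of a letter that differs from the first letter of `X` synchronizes the
product transducer. -/
theorem productStep_iterate (alg : Algorithm) {X : List A} (hX : X ≠ []) {c : A}
    (hc : ¬ [c] <+: X) (q : ProductState X) :
    (fun r => productStep alg hX r c)^[3 + X.length] q =
      (⟨[], nil_mem_strictPrefixes hX⟩, Predictor.stronglyTaken) := by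
  rw [Function.iterate_add_apply]
  -- The first `|X|` letters empty the word component: it is a power of `c` that is a prefix of `X`.
  -- Each of the last 3 letters then outputs a single `T`, enough to saturate the predictor from any
  -- state.
  set r := (fun r => productStep alg hX r c)^[X.length] q with hr
  have hsuf : (r.1 : List A) <:+ List.replicate X.length c := by
    refine List.suffix_of_suffix_length_le (delta_iterate_suffix alg hX q c _)
      (List.suffix_append _ _) ?_
    rw [List.length_replicate]
    exact (length_lt_of_mem_strictPrefixes r.1.2).le
  have hnil : (r.1 : List A) = [] := by
    cases h : (r.1 : List A) with
    | nil => rfl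
    | cons x y =>
      have hx : x = c := by
        have hmem : x ∈ List.replicate X.length c := hsuf.subset (by simp [h])
        exact (List.mem_replicate.1 hmem).2
      refine absurd ((?_ : [c] <+: x :: y).trans (h ▸ (mem_strictPrefixes.1 r.1.2).1)) hc
      simp [hx]
  have hr' : r = (⟨[], nil_mem_strictPrefixes hX⟩, r.2) := Prod.ext (Subtype.ext hnil) rfl
  rw [hr']
  simp only [Function.iterate_succ, Function.iterate_zero, Function.comp_apply, id,
    productStep_nil alg hX hc]
  cases r.2 <;> rfl

theorem productChain_eq_letterChain [Fintype A] (alg : Algorithm) {X : List A} (hX : X ≠ [])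
    (p : A → ℝ) : productChain alg X p = letterChain (productStep alg hX) p := by
  ext q r
  simp only [productChain, letterChain, Matrix.of_apply]
  refine Finset.sum_congr rfl fun a _ => if_congr ?_ rfl rfl
  simp [productTarget, productStep, Prod.ext_iff, Subtype.ext_iff]

/-! ### Expected mispredictions and their rate -/

/-- The expected number of mispredictions on a random text of length `n` from a given state of the
product transducer. -/
noncomputable def expectedMispredictionsFrom [Fintype A] (alg : Algorithm) (X : List A)
    (p : A → ℝ) (n : ℕ) (q : ProductState X) : ℝ :=
  ∑ W : Fin n → A, (∏ i, p (W i)) *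
    (q.2.mispredictions (mainLoop alg X (List.ofFn W) (q.1 : List A).length) : ℝ)

theorem expectedMispredictionsFrom_zero [Fintype A] (alg : Algorithm) (X : List A)
    (p : A → ℝ) (q : ProductState X) : expectedMispredictionsFrom alg X p 0 q = 0 := by
  simp [expectedMispredictionsFrom, mainLoop, Predictor.mispredictions]

theorem expectedMispredictionsFrom_succ [Fintype A] (alg : Algorithm) {X : List A} (hX : X ≠ [])
    {p : A → ℝ} (hp_sum : ∑ a, p a = 1) (n : ℕ) (q : ProductState X) :
    expectedMispredictionsFrom alg X p (n + 1) q =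
      (∑ a, p a * (productOutput alg X q a : ℝ)) +
        ∑ a, p a * expectedMispredictionsFrom alg X p n (productStep alg hX q a) := by
  -- Conditioning on the first letter of the text.
  rw [expectedMispredictionsFrom, ← (Fin.consEquiv fun _ => A).sum_comp, Fintype.sum_prod_type,
    ← Finset.sum_add_distrib]
  refine Finset.sum_congr rfl fun a _ => ?_
  simp only [Fin.consEquiv_apply, Fin.prod_univ_succ, Fin.cons_zero, Fin.cons_succ,
    List.ofFn_succ, mispredictions_mainLoop_cons alg hX, Nat.cast_add, mul_add,
    Finset.sum_add_distrib]
  congr 1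
  · rw [← Finset.sum_mul, ← Finset.mul_sum, sum_prod_eq_one hp_sum, mul_one]
  · rw [expectedMispredictionsFrom, Finset.mul_sum]
    exact Finset.sum_congr rfl fun W _ => mul_assoc _ _ _

theorem mispredictionRate_eq_sum [Fintype A] (alg : Algorithm) (X : List A) (p : A → ℝ)
    (d : ProductState X → ℝ) :
    mispredictionRate alg X p d = ∑ q, d q * ∑ a, p a * (productOutput alg X q a : ℝ) := by
  rw [Fintype.sum_prod_type]
  rfl

/-- The transition from `(ε, stronglyTaken)` reading the first letter of `X` is mispredicted. -/
theorem mispredictionRate_pos [Fintype A] (alg : Algorithm) {X : List A} (hX : X ≠ [])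
    {p : A → ℝ} (hp : ∀ a, 0 < p a) {d : ProductState X → ℝ} (hd : ∀ q, 0 ≤ d q)
    (hpos : 0 < d (⟨[], nil_mem_strictPrefixes hX⟩, Predictor.stronglyTaken)) :
    0 < mispredictionRate alg X p d := by
  have hnn : ∀ q a, 0 ≤ p a * (productOutput alg X q a : ℝ) :=
    fun q a => mul_nonneg (hp a).le (Nat.cast_nonneg _)
  rw [mispredictionRate_eq_sum]
  refine Finset.sum_pos' (fun q _ => mul_nonneg (hd q) (Finset.sum_nonneg fun a _ => hnn q a))
    ⟨_, Finset.mem_univ _, mul_pos hpos (Finset.sum_pos' (fun a _ => hnn _ a)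
      ⟨X.head hX, Finset.mem_univ _, ?_⟩)⟩
  have hpre : [] ++ [X.head hX] <+: X := ⟨X.tail, by simp⟩
  have hout : productOutput alg X (⟨[], nil_mem_strictPrefixes hX⟩, Predictor.stronglyTaken)
      (X.head hX) = 1 := by
    simp only [productOutput]
    rw [output_of_prefix hpre]
    rfl
  rw [hout]
  simpa using hp _

end Transducer

end PatternMatching

/-- Otherwise the alphabet has a single letter, of probability 1. -/
theorem exists_letter_not_prefix {A : Type*} [Fintype A] {p : A → ℝ} (hp : ∀ a, p a < 1)
    (hp_sum : ∑ a, p a = 1) {X : List A} (hX : X ≠ []) : ∃ c, ¬ [c] <+: X := by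
  by_contra! hall
  have huniq : ∀ a, a = X.head hX := by
    intro a
    obtain ⟨r, hr⟩ := hall a
    simp [← hr]
  have : ∑ a, p a = p (X.head hX) :=
    Fintype.sum_eq_single _ fun a ha => absurd (huniq a) ha
  exact (hp _).ne (this.symm.trans hp_sum)

/-- A sequence within bounded distance of a non-zero linear one is equivalent to it. -/
theorem isEquivalent_of_abs_sub_mul_le {f : ℕ → ℝ} {L C : ℝ} (hL : L ≠ 0)
    (h : ∀ n : ℕ, |f n - L * n| ≤ C) :
    Asymptotics.IsEquivalent Filter.atTop f (fun n : ℕ => L * (n : ℝ)) := by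
  have hone : (fun n : ℕ => f n - L * n) =O[Filter.atTop] fun _ => (1 : ℝ) :=
    Asymptotics.IsBigO.of_bound C (Filter.Eventually.of_forall fun n => by simpa using h n)
  refine hone.trans_isLittleO ?_
  refine (Asymptotics.isLittleO_const_left.2 (Or.inr ?_))
  simp only [Function.comp_def, norm_mul]
  refine Filter.Tendsto.const_mul_atTop (norm_pos_iff.2 hL) ?_
  simpa using tendsto_natCast_atTop_atTop (R := ℝ)

theorem mainTheorem1 {A : Type*} [Fintype A] [DecidableEq A]
    (p : A → ℝ) (hp : ∀ a, 0 < p a ∧ p a < 1) (hp_sum : ∑ a, p a = 1)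
    (X : List A) (hX : X ≠ []) (alg : Algorithm) :
    (∃! d : PatternMatching.ProductState X → ℝ,
        PatternMatching.IsStationaryDistribution (PatternMatching.productChain alg X p) d) ∧
      ∀ d : PatternMatching.ProductState X → ℝ,
        PatternMatching.IsStationaryDistribution (PatternMatching.productChain alg X p) d →
          ∀ l₀ : Predictor,
            Asymptotics.IsEquivalent Filter.atTop
              (fun n : ℕ => PatternMatching.expectedLetterMispredictions alg X p l₀ n)
              (fun n : ℕ => PatternMatching.mispredictionRate alg X p d * (n : ℝ)) := by
  obtain ⟨c, hc⟩ := exists_letter_not_prefix (fun a => (hp a).2) hp_sum hX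
  have hpos := fun a => (hp a).1
  have hsync := PatternMatching.productStep_iterate alg hX hc
  have hnil := PatternMatching.nil_mem_strictPrefixes hX
  rw [PatternMatching.productChain_eq_letterChain alg hX p]
  constructor
  · have : Nonempty (PatternMatching.ProductState X) :=
      ⟨(⟨[], hnil⟩, Predictor.stronglyTaken)⟩
    obtain ⟨d, hd⟩ := exists_isStationaryDistribution_letterChain
      (PatternMatching.productStep alg hX) hpos hp_sum
    refine ⟨d, hd, fun e he => sub_eq_zero.1 ?_⟩
    refine eq_zero_of_vecMul_letterChain_eq _ hpos hp_sum hsync ?_ ?_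
    · rw [Matrix.sub_vecMul, hd.2.2, he.2.2]
    · simp [Finset.sum_sub_distrib, hd.2.1, he.2.1]
  · intro d hd l₀
    -- A distribution of mass 1 charges some state, hence the synchronizing one, which makes the
    -- rate positive.
    have hex : ∃ q, 0 < d q := by
      by_contra! hle
      exact absurd hd.2.1
        (by linarith [Finset.sum_nonpos fun q (_ : q ∈ Finset.univ) => hle q] : ∑ q, d q ≠ 1)
    obtain ⟨q, hq⟩ := hex
    have hrate := PatternMatching.mispredictionRate_pos alg hX hpos hd.1
      (pos_of_vecMul_letterChain_eq _ hpos hsync hd.1 hd.2.2 hq)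
    obtain ⟨C, hC⟩ := exists_abs_sub_le_of_letterChain _ hpos hp_sum hsync hd _
      (PatternMatching.expectedMispredictionsFrom_zero alg X p)
      (PatternMatching.expectedMispredictionsFrom_succ alg hX hp_sum)
    refine isEquivalent_of_abs_sub_mul_le (C := C) hrate.ne' fun n => ?_
    -- At `(ε, l₀)` the word has length 0, which is the initial value of `i`.
    have := hC n (⟨[], hnil⟩, l₀)
    rwa [← PatternMatching.mispredictionRate_eq_sum] at this
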